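/- Let $\{\xi_n\}_{n\ge 1}$ be i.i.d. real random variables with generic copy $\xi$, $\mathbb{E}\,\xi=0$ and $\mathbb{E}\,\xi^2=\sigma^2\in(0,\infty)$, and let $\{\eta_n\}_{n\ge 1}$ be i.i.d. positive random variables with generic copy $\eta$, independent of $\{\xi_n\}_{n\ge1}$. Define the random walk $\tilde S$ by $\tilde S(0)=0$ and, for $n\ge 0$, $$\tilde S(n+1)=\begin{cases}\tilde S(n)+\xi_{n+1} & \text{if } \tilde S(n)>0,\\ \tilde S(n)+\eta_{n+1} & \text{if } \tilde S(n)\le 0,\end{cases}$$ and extend it to real times $t\ge 0$ by $\tilde S(t)=\tilde S(\lfloor t\rfloor)$. Suppose that $\eta$ has a slowly varying tail: $\mathbb{P}(\eta>x)\sim l(x)$ as $x\to\infty$ for some slowly varying function $l$, i.e. a function that is measurable and positive on some half-line $[A,\infty)$ and satisfies $l(rx)/l(x)\to 1$ as $x\to\infty$ for every $r>0$. Then the sequence of processes $$\Big\{\tfrac{1}{\sqrt n}\tilde S(nt),\ t\in[0,1]\Big\}_{n\ge 1}$$ has no weak limit in the Skorokhod space $\mathcal{D}[0,1]$ of càdlàg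 functions with the $J_1$ topology: there is no Borel probability measure on $\mathcal{D}[0,1]$ to which their laws converge weakly. Moreover, for every $t>0$, $$\max_{0\le s\le t}\frac{\tilde S(ns)}{\sqrt n}\ \xrightarrow{\ \mathbb{P}\ }\ \infty,\qquad n\to\infty,$$ that is, $\mathbb{P}\big(\max_{0\le s\le t}\tilde S(ns)/\sqrt n>c\big)\to 1$ for every $c\in\mathbb{R}$. -/

import Mathlib

open Set Filter Topology MeasureTheory ProbabilityTheory
open scoped ENNReal

/-! ### The Skorokhod space `D[0,1]` -/

/-- A function `x : [0,1] → ℝ` is càdlàg if it is right-continuous and has a finite left limit at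
every point (the filter `𝓝[<] 0` on `[0,1]` is trivial, as is right-continuity at `1`). -/
def IsCadlag (x : unitInterval → ℝ) : Prop :=
  ∀ t : unitInterval, ContinuousWithinAt x (Ici t) t ∧ ∃ a : ℝ, Tendsto x (𝓝[<] t) (𝓝 a)

/-- The set `D[0,1]` of càdlàg functions `[0,1] → ℝ`. -/
structure SkorokhodSpace where
  /-- the underlying function -/
  toFun : unitInterval → ℝ
  /-- right-continuity and existence of left limits -/
  cadlag : IsCadlag toFun

namespace SkorokhodSpace

instance : CoeFun SkorokhodSpace (fun _ => unitInterval → ℝ) := ⟨toFun⟩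

/-- The cost of matching `x` with `y` by the time change `θ`, an increasing bijection of `[0,1]`
onto itself: the larger of `sup |θ(t) - t|` and `sup |x(t) - y(θ(t))|`. -/
noncomputable def matchCost (x y : SkorokhodSpace) (θ : unitInterval ≃o unitInterval) : ℝ≥0∞ :=
  max (⨆ t : unitInterval, edist (θ t) t) (⨆ t : unitInterval, edist (x t) (y (θ t)))

/-- Skorokhod's `J₁` metric on `D[0,1]`: the infimum of the matching costs over all time changes. -/
noncomputable instance : EDist SkorokhodSpace := ⟨fun x y => ⨅ θ : unitInterval ≃o unitInterval, matchCost x y θ⟩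

theorem edist_eq (x y : SkorokhodSpace) : edist x y = ⨅ θ : unitInterval ≃o unitInterval, matchCost x y θ := rfl

theorem matchCost_symm_le (x y : SkorokhodSpace) (θ : unitInterval ≃o unitInterval) :
    matchCost y x θ.symm ≤ matchCost x y θ := by
  refine max_le_max ?_ ?_
  · refine iSup_le fun t => ?_
    refine le_trans (le_of_eq ?_) (le_iSup (fun t : unitInterval => edist (θ t) t) (θ.symm t))
    simp [edist_comm]
  · refine iSup_le fun t => ?_
    refine le_trans (le_of_eq ?_) (le_iSup (fun t : unitInterval => edist (x t) (y (θ t))) (θ.symm t))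
    simp [edist_comm]

theorem matchCost_trans_le (x y z : SkorokhodSpace) (θ₁ θ₂ : unitInterval ≃o unitInterval) :
    matchCost x z (θ₁.trans θ₂) ≤ matchCost x y θ₁ + matchCost y z θ₂ := by
  refine max_le ?_ ?_
  · refine iSup_le fun t => ?_
    have h1 : edist (θ₁ t) t ≤ matchCost x y θ₁ :=
      (le_iSup (fun t : unitInterval => edist (θ₁ t) t) t).trans (le_max_left _ _)
    have h2 : edist (θ₂ (θ₁ t)) (θ₁ t) ≤ matchCost y z θ₂ :=
      (le_iSup (fun t : unitInterval => edist (θ₂ t) t) (θ₁ t)).trans (le_max_left _ _)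
    calc edist ((θ₁.trans θ₂) t) t ≤ edist (θ₂ (θ₁ t)) (θ₁ t) + edist (θ₁ t) t :=
          edist_triangle _ _ _
      _ ≤ matchCost y z θ₂ + matchCost x y θ₁ := add_le_add h2 h1
      _ = _ := add_comm _ _
  · refine iSup_le fun t => ?_
    have h1 : edist (x t) (y (θ₁ t)) ≤ matchCost x y θ₁ :=
      (le_iSup (fun t : unitInterval => edist (x t) (y (θ₁ t))) t).trans (le_max_right _ _)
    have h2 : edist (y (θ₁ t)) (z (θ₂ (θ₁ t))) ≤ matchCost y z θ₂ :=
      (le_iSup (fun t : unitInterval => edist (y t) (z (θ₂ t))) (θ₁ t)).trans (le_max_right _ _)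
    exact (edist_triangle _ _ _).trans (add_le_add h1 h2)

/-- `D[0,1]` with the `J₁` metric and its topology. -/
noncomputable instance : PseudoEMetricSpace SkorokhodSpace where
  edist_self x := by
    refine le_antisymm (iInf_le_of_le (OrderIso.refl unitInterval) ?_) bot_le
    simp [matchCost]
  edist_comm x y := by
    have key : ∀ x y : SkorokhodSpace, edist x y ≤ edist y x := fun x y =>
      le_iInf fun θ => iInf_le_of_le θ.symm (matchCost_symm_le y x θ)
    exact le_antisymm (key x y) (key y x)
  edist_triangle x y z := by
    rw [edist_eq x y, edist_eq y z]
    exact ENNReal.le_iInf_add_iInf fun θ₁ θ₂ =>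
      iInf_le_of_le (θ₁.trans θ₂) (matchCost_trans_le x y z θ₁ θ₂)

/-- `D[0,1]` carries the Borel σ-algebra of the `J₁` topology. -/
noncomputable instance : MeasurableSpace SkorokhodSpace := borel SkorokhodSpace

instance : BorelSpace SkorokhodSpace := ⟨rfl⟩

end SkorokhodSpace

/-! ### Flat interpolation -/

/-- The flat-right interpolation `S(t) = S(⌊t⌋)`, `t ≥ 0`, of a sequence. -/
noncomputable def flatInterp (S : ℕ → ℝ) (t : ℝ) : ℝ := S ⌊t⌋₊

theorem isCadlag_flatInterp (n : ℕ) (S : ℕ → ℝ) :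
    IsCadlag (fun t : unitInterval => flatInterp S (n * t)) := by
  have hcont : Continuous fun s : unitInterval => (n : ℝ) * (s : ℝ) := by fun_prop
  intro t
  constructor
  · have h1 : Tendsto (fun s : unitInterval => (n : ℝ) * (s : ℝ)) (𝓝[≥] t) (𝓝[≥] ((n : ℝ) * t)) :=
      tendsto_nhdsWithin_of_tendsto_nhds_of_eventually_within _
        (hcont.tendsto t |>.mono_left nhdsWithin_le_nhds)
        (eventually_nhdsWithin_of_forall fun s hs =>
          mul_le_mul_of_nonneg_left (show (t : ℝ) ≤ s from hs) n.cast_nonneg)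
    have h2 := (tendsto_floor_right_pure_floor ((n : ℝ) * t)).comp h1
    rw [tendsto_pure] at h2
    refine tendsto_nhds_of_eventually_eq ?_
    filter_upwards [h2] with s hs
    simp only [Function.comp_apply] at hs
    simp [flatInterp, ← Int.floor_toNat, hs]
  · rcases Nat.eq_zero_or_pos n with rfl | hn
    · exact ⟨S 0, by simpa [flatInterp] using tendsto_const_nhds⟩
    · have h1 : Tendsto (fun s : unitInterval => (n : ℝ) * (s : ℝ)) (𝓝[<] t) (𝓝[<] ((n : ℝ) * t)) :=
        tendsto_nhdsWithin_of_tendsto_nhds_of_eventually_within _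
          (hcont.tendsto t |>.mono_left nhdsWithin_le_nhds)
          (eventually_nhdsWithin_of_forall fun s hs =>
            mul_lt_mul_of_pos_left (show (s : ℝ) < t from hs) (by exact_mod_cast hn))
      have h2 := (tendsto_floor_left_pure_ceil_sub_one ((n : ℝ) * t)).comp h1
      rw [tendsto_pure] at h2
      refine ⟨S (⌈(n : ℝ) * t⌉ - 1).toNat, tendsto_nhds_of_eventually_eq ?_⟩
      filter_upwards [h2] with s hs
      simp only [Function.comp_apply] at hs
      simp [flatInterp, ← Int.floor_toNat, hs]

/-- The path `t ↦ S(⌊nt⌋) / √n`, `t ∈ [0,1]`, as an element of `D[0,1]`. -/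
noncomputable def rescaledPath (S : ℕ → ℝ) (n : ℕ) : SkorokhodSpace where
  toFun t := flatInterp S (n * t) / Real.sqrt n
  cadlag := isCadlag_flatInterp n fun k => S k / Real.sqrt n

/-- For a random sequence `S`, the rescaled path is a random element of `D[0,1]`. -/
theorem measurable_rescaledPath {Ω : Type*} [MeasurableSpace Ω] {S : Ω → ℕ → ℝ}
    (hS : ∀ k, Measurable fun ω => S ω k) (n : ℕ) :
    Measurable fun ω => rescaledPath (S ω) n := by
  let G : (Fin (n + 1) → ℝ) → SkorokhodSpace := fun v =>
    ⟨fun t => flatInterp (fun k => if h : k < n + 1 then v ⟨k, h⟩ else 0) (n * t),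
      isCadlag_flatInterp n _⟩
  have key : ∀ (v w : Fin (n + 1) → ℝ) (k : ℕ),
      edist (if h : k < n + 1 then v ⟨k, h⟩ else 0) (if h : k < n + 1 then w ⟨k, h⟩ else 0)
        ≤ edist v w := by
    intro v w k
    split_ifs with h
    · exact edist_le_pi_edist v w _
    · simp
  have hG : LipschitzWith 1 G := by
    intro v w
    rw [ENNReal.coe_one, one_mul, SkorokhodSpace.edist_eq]
    refine iInf_le_of_le (OrderIso.refl unitInterval) (max_le (iSup_le fun t => by simp) ?_)
    exact iSup_le fun t => key v w _
  have hm : Measurable fun ω => G fun i : Fin (n + 1) => S ω i / Real.sqrt n :=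
    hG.continuous.measurable.comp (measurable_pi_lambda _ fun i => (hS i).div_const _)
  convert hm using 1
  funext ω
  simp only [rescaledPath, G, flatInterp]
  congr 1
  funext t
  have : ⌊(n : ℝ) * t⌋₊ < n + 1 := by
    have h1 : (n : ℝ) * t ≤ n := mul_le_of_le_one_right n.cast_nonneg t.2.2
    have h2 : ⌊(n : ℝ) * t⌋₊ ≤ ⌊(n : ℝ)⌋₊ := Nat.floor_le_floor h1
    rw [Nat.floor_natCast] at h2
    omega
  simp [this]

/-! ### The random walk -/

/-- The walk started at `0` which moves by an increment `ξ` from `(0, ∞)` and by an increment `η`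
from `(-∞, 0]`. The sequences are indexed from `0`: `ξ n` and `η n` here are the increments
usually written `ξ_{n+1}` and `η_{n+1}`. -/
noncomputable def switchedWalk {Ω : Type*} (ξ η : ℕ → Ω → ℝ) (ω : Ω) : ℕ → ℝ
  | 0 => 0
  | n + 1 =>
    if 0 < switchedWalk ξ η ω n then switchedWalk ξ η ω n + ξ n ω
    else switchedWalk ξ η ω n + η n ω

theorem measurable_switchedWalk {Ω : Type*} [MeasurableSpace Ω] {ξ η : ℕ → Ω → ℝ}
    (hξ : ∀ n, Measurable (ξ n)) (hη : ∀ n, Measurable (η n)) (k : ℕ) :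
    Measurable fun ω => switchedWalk ξ η ω k := by
  induction k with
  | zero => exact measurable_const
  | succ k ih =>
    exact Measurable.ite (measurableSet_lt measurable_const ih) (ih.add (hξ k)) (ih.add (hη k))

/-- The law on `D[0,1]` of the rescaled walk `t ↦ S(nt) / √n`. -/
noncomputable def rescaledWalkLaw {Ω : Type*} [MeasurableSpace Ω] (P : ProbabilityMeasure Ω)
    {ξ η : ℕ → Ω → ℝ} (hξ : ∀ n, Measurable (ξ n)) (hη : ∀ n, Measurable (η n)) (n : ℕ) :
    ProbabilityMeasure SkorokhodSpace :=
  P.map (f := fun ω => rescaledPath (switchedWalk ξ η ω) n)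
    (measurable_rescaledPath (measurable_switchedWalk hξ hη) n).aemeasurable

/-- The maximum over real times `s ∈ [0,t]` of `S(ns) / √n`. For `t ≥ 0` the function
takes finitely many values on `[0,t]`, so that the supremum is a maximum. -/
noncomputable def rescaledMax (S : ℕ → ℝ) (n : ℕ) (t : ℝ) : ℝ :=
  ⨆ s : Icc (0 : ℝ) t, flatInterp S (n * s) / Real.sqrt n

/-- The real random variables `Y n` tend to `+∞` in probability. -/
def TendstoInfinityInProbability {Ω : Type*} [MeasurableSpace Ω] (P : Measure Ω)
    (Y : ℕ → Ω → ℝ) : Prop :=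
  ∀ c : ℝ, Tendsto (fun n => P {ω | c < Y n ω}) atTop (𝓝 1)

/-! ### Slow variation -/

/-- The class `R₀` of slowly varying functions: measurable and positive on a half-line `[A, ∞)`,
with `l (r x) / l x → 1` as `x → ∞` for every `r > 0`. -/
def IsSlowlyVarying (l : ℝ → ℝ) : Prop :=
  (∃ A : ℝ, Measurable ((Ici A).domRestrict l) ∧ ∀ x ∈ Ici A, 0 < l x) ∧
    ∀ r : ℝ, 0 < r → Tendsto (fun x => l (r * x) / l x) atTop (𝓝 1)

/-! ### Functions of dominated doubling -/

/-! Both conclusions follow from one estimate: for all `t, B > 0`, the probability that the walk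
stays below `b = B√n` up to time `nt` tends to `0`. The mechanism is a single huge upward jump: when
the tail of `η` varies slowly, the jumps of size at most `2b` made before the first jump above `2b`
add up to only `o(b)` on average.

Write `G(x) = P(η > x)`, `M(x) = E[η; 0 < η ≤ x]`, and confine the walk to `[-a, b]` with `a = δb`.
From a nonpositive site of the band, a jump above `2b` leaves it, so the expected number of confined
nonpositive visits is at most `1 / G(2b)` (`sum_measureReal_confinedNonpos_le`). Confined positive
visits are counted with the concave potential `V(s) = (s + a)(2b - s)`, killed at exit: it loses at
least `σ²/2` on average at a positive site and gains at most `3b M(2b)` at a nonpositive one. Since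
`V(0) = 2ab`, the expected positive time is at most `(2/σ²)(2ab + 3b M(2b)/G(2b))`.

Slow variation gives `x G(x) → ∞` and `M(x) / (x G(x)) → 0`, so the total expected confined time up
to `nt` is at most `(4δ/σ²) b² + o(b²)`. As `b²` is of order `n`, confinement up to time `nt` has
probability `O(δ) + o(1)`. Leaving through `-a` needs some `ξ_j < -a`; among `O(n)` steps this has
probability `o(1)` for fixed `δ`, by the finite variance.

A weak limit would, by the portmanteau theorem, give mass `0` to each open set of paths with
supremum below `c`, although these sets exhaust `D[0,1]`. -/

theorem doubling_induction {p : ℝ → Prop} {x₀ : ℝ} (hx₀ : 0 < x₀)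
    (base : ∀ x ∈ Icc x₀ (2 * x₀), p x) (step : ∀ x, x₀ ≤ x → p x → p (2 * x)) :
    ∀ x, x₀ ≤ x → p x := by
  have key : ∀ n : ℕ, ∀ x, x₀ ≤ x → x ≤ 2 ^ n * x₀ → p x := by
    intro n
    induction n with
    | zero => exact fun x h1 h2 => base x ⟨h1, by linarith⟩
    | succ n ih =>
      intro x h1 h2
      by_cases h : x ≤ 2 * x₀
      · exact base x ⟨h1, h⟩
      · have := step (x / 2) (by linarith) (ih (x / 2) (by linarith) (by rw [pow_succ] at h2; linarith))
        rwa [mul_div_cancel₀ x two_ne_zero] at this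
  intro x hx
  obtain ⟨n, hn⟩ := pow_unbounded_of_one_lt (x / x₀) (one_lt_two : (1 : ℝ) < 2)
  exact key n x hx ((div_lt_iff₀ hx₀).1 hn).le

section Tail

variable {G M : ℝ → ℝ}

theorem exists_le_mul_of_tendsto_div (hpos : ∀ x, 0 < G x)
    (hG : Tendsto (fun x => G (2 * x) / G x) atTop (𝓝 1)) {ε : ℝ} (hε : 0 < ε) :
    ∃ x₀, 0 < x₀ ∧ ∀ x, x₀ ≤ x → G x ≤ (1 + ε) * G (2 * x) := by
  have h1 : (1 + ε)⁻¹ < 1 := inv_lt_one_of_one_lt₀ (by linarith)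
  obtain ⟨x₁, h⟩ := eventually_atTop.1 (hG.eventually (lt_mem_nhds h1))
  refine ⟨max x₁ 1, by positivity, fun x hx => ?_⟩
  have h2 := h x ((le_max_left _ _).trans hx)
  rw [lt_div_iff₀ (hpos x), inv_mul_lt_iff₀ (by linarith)] at h2
  exact h2.le

/-- Eventually `G x ≤ (4/3) G (2x)`, so each doubling multiplies `x G x` by at least `3/2 > √2`, and
`x G x` outgrows a multiple of `√x`. -/
theorem tendsto_mul_self_atTop_of_tendsto_div (hpos : ∀ x, 0 < G x) (hanti : Antitone G)
    (hG : Tendsto (fun x => G (2 * x) / G x) atTop (𝓝 1)) :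
    Tendsto (fun x => x * G x) atTop atTop := by
  obtain ⟨x₀, hx₀, h⟩ := exists_le_mul_of_tendsto_div hpos hG (show (0 : ℝ) < 1 / 3 by norm_num)
  set c := x₀ * G (2 * x₀) / √(2 * x₀) with hc
  have hcpos : 0 < c := by have := hpos (2 * x₀); positivity
  have key : ∀ x, x₀ ≤ x → c * √x ≤ x * G x := by
    refine doubling_induction hx₀ ?_ ?_
    · rintro x ⟨h1, h2⟩
      calc c * √x ≤ c * √(2 * x₀) := by gcongr
        _ = x₀ * G (2 * x₀) := by rw [hc]; field_simp
        _ ≤ x * G x := by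
          exact mul_le_mul h1 (hanti h2) (hpos _).le (by linarith)
    · intro x hx hp
      have h1 := h x hx
      have hs : √(2 * x) ≤ 3 / 2 * √x := by
        rw [Real.sqrt_le_left (by positivity), mul_pow, Real.sq_sqrt (by linarith)]
        linarith
      have h2 : x * G x ≤ x * ((1 + 1 / 3) * G (2 * x)) := by
        gcongr
        linarith
      nlinarith [mul_le_mul_of_nonneg_left hs hcpos.le]
  refine tendsto_atTop_mono' _ ((eventually_ge_atTop x₀).mono key) ?_
  exact (Real.tendsto_sqrt_atTop).const_mul_atTop hcpos

/-- A form of Karamata's theorem, with `M` the truncated mean. One doubling adds at most `2εx G(2x)`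
to `M`, while `x G x` roughly doubles; hence `M x ≤ 4ε x G x + D`, and `D` is absorbed because `x G
x → ∞`. -/
theorem tendsto_div_mul_self_of_tendsto_div (hpos : ∀ x, 0 < G x) (hanti : Antitone G)
    (hG : Tendsto (fun x => G (2 * x) / G x) atTop (𝓝 1)) (hM0 : ∀ x, 0 ≤ M x)
    (hM : Monotone M)
    (hMG : ∀ x, 0 < x → M (2 * x) ≤ M x + 2 * x * (G x - G (2 * x))) :
    Tendsto (fun x => M x / (x * G x)) atTop (𝓝 0) := by
  have hinf := tendsto_mul_self_atTop_of_tendsto_div hpos hanti hG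
  rw [Metric.tendsto_atTop]
  suffices H : ∀ ε : ℝ, 0 < ε → ε ≤ 1 / 2 → ∀ᶠ x in atTop, M x / (x * G x) ≤ 5 * ε by
    intro ε hε
    obtain ⟨N, hN⟩ := eventually_atTop.1 (H (min (ε / 6) (1 / 2)) (by positivity) (min_le_right _ _))
    refine ⟨max N 1, fun x hx => ?_⟩
    have h1 := hN x ((le_max_left _ _).trans hx)
    have hx0 : 0 < x := lt_of_lt_of_le one_pos ((le_max_right _ _).trans hx)
    have h0 : 0 ≤ M x / (x * G x) := div_nonneg (hM0 x) (mul_pos hx0 (hpos x)).le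
    rw [Real.dist_eq, sub_zero, abs_of_nonneg h0]
    have := min_le_left (ε / 6) (1 / 2)
    linarith
  intro ε hε hε2
  obtain ⟨x₀, hx₀, h⟩ := exists_le_mul_of_tendsto_div hpos hG hε
  set D := M (2 * x₀)
  have key : ∀ x, x₀ ≤ x → M x ≤ 4 * ε * (x * G x) + D := by
    refine doubling_induction hx₀ ?_ ?_
    · rintro x ⟨h1, h2⟩
      have : 0 < x * G x := mul_pos (by linarith) (hpos x)
      have := hM h2
      have : 0 ≤ 4 * ε * (x * G x) := by positivity
      linarith
    · intro x hx hp
      have hx0 : 0 < x := by linarith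
      have h1 := h x hx
      have h2 := hMG x hx0
      have hq := mul_pos hx0 (hpos (2 * x))
      have h3 : x * G x ≤ (1 + ε) * (x * G (2 * x)) := by
        have := mul_le_mul_of_nonneg_left h1 hx0.le
        linarith
      have h4 : 4 * ε * (x * G x) ≤ 4 * ε * ((1 + ε) * (x * G (2 * x))) := by gcongr
      have h5 : ε * ε * (x * G (2 * x)) ≤ 1 / 2 * ε * (x * G (2 * x)) := by gcongr
      -- The constant `4` closes the induction: `4(1 + ε) + 2 ≤ 8` because `ε ≤ 1/2`.
      nlinarith
  filter_upwards [eventually_ge_atTop x₀, hinf.eventually_ge_atTop (D / ε), eventually_gt_atTop 0]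
    with x h1 h2 h3
  rw [div_le_iff₀ (mul_pos h3 (hpos x))]
  rw [div_le_iff₀ hε] at h2
  have := key x h1
  linarith

end Tail

/-! ### Independence of the past -/

section Past

variable {Ω : Type*}

/-- The σ-algebra generated by the increments available before time `k`. -/
abbrev pastSigma (ξ η : ℕ → Ω → ℝ) (k : ℕ) : MeasurableSpace Ω :=
  MeasurableSpace.comap
    (fun ω => ((fun j : Finset.range k => ξ j ω), (fun j : Finset.range k => η j ω))) inferInstance

theorem pastSigma_comm (ξ η : ℕ → Ω → ℝ) (k : ℕ) : pastSigma η ξ k = pastSigma ξ η k := by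
  have h (f g : Ω → (Finset.range k → ℝ)) :
      MeasurableSpace.comap (fun ω => (f ω, g ω)) inferInstance ≤
        MeasurableSpace.comap (fun ω => (g ω, f ω)) inferInstance := by
    let _ := MeasurableSpace.comap (fun ω => (g ω, f ω)) inferInstance
    have h1 : Measurable (fun ω => (g ω, f ω)) := comap_measurable _
    exact (measurable_swap.comp h1).comap_le
  exact le_antisymm (h _ _) (h _ _)

theorem measurable_pastSigma_left (ξ η : ℕ → Ω → ℝ) {j k : ℕ} (h : j < k) :
    Measurable[pastSigma ξ η k] (ξ j) := by
  let _ := pastSigma ξ η k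
  have h1 : Measurable
      (fun ω => ((fun j : Finset.range k => ξ j ω), (fun j : Finset.range k => η j ω))) :=
    comap_measurable _
  exact ((measurable_pi_apply (⟨j, Finset.mem_range.2 h⟩ : Finset.range k)).comp
    measurable_fst).comp h1

theorem measurable_pastSigma_switchedWalk (ξ η : ℕ → Ω → ℝ) {j k : ℕ} (h : j ≤ k) :
    Measurable[pastSigma ξ η k] (fun ω => switchedWalk ξ η ω j) := by
  let _ := pastSigma ξ η k
  induction j with
  | zero => exact measurable_const
  | succ j ih =>
    have ih := ih (by omega)
    have h1 := measurable_pastSigma_left ξ η (show j < k by omega)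
    have h2 := measurable_pastSigma_left η ξ (show j < k by omega)
    rw [pastSigma_comm] at h2
    exact Measurable.ite (measurableSet_lt measurable_const ih) (ih.add h1) (ih.add h2)

end Past

section Indep

variable {Ω : Type*} {mΩ : MeasurableSpace Ω} {P : Measure Ω} [IsProbabilityMeasure P]

/-- The joint law is the product of the three marginals, and products of measures are associative.
-/
theorem indepFun_prodMk_assoc {α β γ : Type*} [MeasurableSpace α] [MeasurableSpace β]
    [MeasurableSpace γ] {f : Ω → α} {g : Ω → β} {h : Ω → γ} (hf : Measurable f)
    (hg : Measurable g) (hh : Measurable h) (hfg : IndepFun f g P)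
    (hfgh : IndepFun (fun ω => (f ω, g ω)) h P) : IndepFun f (fun ω => (g ω, h ω)) P := by
  have : IsProbabilityMeasure (P.map f) := Measure.isProbabilityMeasure_map hf.aemeasurable
  have : IsProbabilityMeasure (P.map g) := Measure.isProbabilityMeasure_map hg.aemeasurable
  have : IsProbabilityMeasure (P.map h) := Measure.isProbabilityMeasure_map hh.aemeasurable
  have hgh : IndepFun g h P := hfgh.comp measurable_snd measurable_id
  rw [indepFun_iff_map_prod_eq_prod_map_map (by fun_prop) (by fun_prop)] at *
  rw [hgh, ← (measurePreserving_prodAssoc _ _ _).map_eq, ← hfg, ← hfgh,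
    Measure.map_map (by fun_prop) (by fun_prop)]
  rfl

theorem pastSigma_le {ξ η : ℕ → Ω → ℝ} (hξ : ∀ n, Measurable (ξ n)) (hη : ∀ n, Measurable (η n))
    (k : ℕ) : pastSigma ξ η k ≤ mΩ := by
  apply Measurable.comap_le
  fun_prop

theorem indep_pastSigma_left {ξ η : ℕ → Ω → ℝ} (hξ : ∀ n, Measurable (ξ n))
    (hη : ∀ n, Measurable (η n)) (hξ_indep : iIndepFun ξ P)
    (hξη : IndepFun (fun ω n => ξ n ω) (fun ω n => η n ω) P) (k : ℕ) :
    Indep (pastSigma ξ η k) (MeasurableSpace.comap (ξ k) inferInstance) P := by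
  refine Indep.symm ?_
  change IndepFun (ξ k)
    (fun ω => ((fun j : Finset.range k => ξ j ω), (fun j : Finset.range k => η j ω))) P
  refine indepFun_prodMk_assoc (hξ k) (by fun_prop) (by fun_prop) ?_ ?_
  · have := iIndepFun.indepFun_finset {k} (Finset.range k) (by simp) hξ_indep hξ
    exact this.comp (measurable_pi_apply (⟨k, Finset.mem_singleton_self k⟩ : ({k} : Finset ℕ)))
      measurable_id
  · exact hξη.comp (φ := fun x : ℕ → ℝ => (x k, fun j : Finset.range k => x j))
      (ψ := fun x : ℕ → ℝ => fun j : Finset.range k => x j) (by fun_prop) (by fun_prop)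

theorem indep_pastSigma_right {ξ η : ℕ → Ω → ℝ} (hξ : ∀ n, Measurable (ξ n))
    (hη : ∀ n, Measurable (η n)) (hη_indep : iIndepFun η P)
    (hξη : IndepFun (fun ω n => ξ n ω) (fun ω n => η n ω) P) (k : ℕ) :
    Indep (pastSigma ξ η k) (MeasurableSpace.comap (η k) inferInstance) P :=
  pastSigma_comm ξ η k ▸ indep_pastSigma_left hη hξ hη_indep hξη.symm k

end Indep

/-! ### The exit time of the walk from a band -/

section Confined

variable {Ω : Type*}

/-- The event that the walk stays in `[-a, b]` up to time `k`. -/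
def confined (ξ η : ℕ → Ω → ℝ) (a b : ℝ) (k : ℕ) : Set Ω :=
  {ω | ∀ j ≤ k, switchedWalk ξ η ω j ∈ Icc (-a) b}

/-- The event that the walk stays in `[-a, b]` up to time `k` and is positive at time `k`. -/
def confinedPos (ξ η : ℕ → Ω → ℝ) (a b : ℝ) (k : ℕ) : Set Ω :=
  confined ξ η a b k ∩ {ω | 0 < switchedWalk ξ η ω k}

/-- The event that the walk stays in `[-a, b]` up to time `k` and is nonpositive at time `k`. -/
def confinedNonpos (ξ η : ℕ → Ω → ℝ) (a b : ℝ) (k : ℕ) : Set Ω :=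
  confined ξ η a b k ∩ {ω | switchedWalk ξ η ω k ≤ 0}

variable {ξ η : ℕ → Ω → ℝ} {a b : ℝ} {k : ℕ}

theorem mem_confined_succ {ω : Ω} : ω ∈ confined ξ η a b (k + 1) ↔
    ω ∈ confined ξ η a b k ∧ switchedWalk ξ η ω (k + 1) ∈ Icc (-a) b := by
  simp only [confined, mem_ofPred_eq]
  refine ⟨fun h => ⟨fun j hj => h j (by omega), h _ le_rfl⟩, fun h j hj => ?_⟩
  rcases Nat.lt_or_ge j (k + 1) with h1 | h1
  · exact h.1 j (by omega)
  · exact (show j = k + 1 by omega) ▸ h.2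

theorem measurableSet_pastSigma_confined (ξ η : ℕ → Ω → ℝ) (a b : ℝ) (k : ℕ) :
    MeasurableSet[pastSigma ξ η k] (confined ξ η a b k) := by
  let _ := pastSigma ξ η k
  have : confined ξ η a b k = ⋂ j, ⋂ (_ : j ≤ k), (fun ω => switchedWalk ξ η ω j) ⁻¹' Icc (-a) b := by
    ext; simp [confined]
  rw [this]
  exact MeasurableSet.iInter fun j => MeasurableSet.iInter fun h =>
    measurable_pastSigma_switchedWalk ξ η h measurableSet_Icc

theorem measurableSet_pastSigma_confinedPos (ξ η : ℕ → Ω → ℝ) (a b : ℝ) (k : ℕ) :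
    MeasurableSet[pastSigma ξ η k] (confinedPos ξ η a b k) :=
  (measurableSet_pastSigma_confined ξ η a b k).inter
    (measurable_pastSigma_switchedWalk ξ η le_rfl measurableSet_Ioi)

theorem measurableSet_pastSigma_confinedNonpos (ξ η : ℕ → Ω → ℝ) (a b : ℝ) (k : ℕ) :
    MeasurableSet[pastSigma ξ η k] (confinedNonpos ξ η a b k) :=
  (measurableSet_pastSigma_confined ξ η a b k).inter
    (measurable_pastSigma_switchedWalk ξ η le_rfl measurableSet_Iic)

/-- The concave function `(s + a) (2 b - s)` of the walk, killed at the exit from `[-a, b]`. -/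
noncomputable def confinedPotential (ξ η : ℕ → Ω → ℝ) (a b : ℝ) (k : ℕ) (ω : Ω) : ℝ :=
  (confined ξ η a b k).indicator
    (fun ω => (switchedWalk ξ η ω k + a) * (2 * b - switchedWalk ξ η ω k)) ω

/-- One step of the potential from a positive position. -/
theorem potential_step_pos {a b s x : ℝ} (ha : 0 < a) (hab : a ≤ b) (hs : 0 < s) (hsb : s ≤ b) :
    (Icc (-a) b).indicator (fun y => (y + a) * (2 * b - y)) (s + x) ≤
      (s + a) * (2 * b - s) + (2 * b - a - 2 * s) * x -
        (x ^ 2 - (2 * b / a + 1) * {y : ℝ | a < |y|}.indicator (fun y => y ^ 2) x) := by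
  have hC : 0 ≤ (2 * b / a + 1) * {y : ℝ | a < |y|}.indicator (fun y => y ^ 2) x :=
    mul_nonneg (by have := ha.trans_le hab; positivity) (indicator_nonneg (fun y _ => sq_nonneg y) x)
  -- The quadratic is nonnegative up to `2b`, so killing above `b` only lowers the left side there.
  -- Outside this interval `|x| > a`, and the truncated term with factor `2b/a + 1` pays for both
  -- `x²` and the linear term.
  by_cases h : s + x ∈ Icc (-a) (2 * b)
  · have h0 : (Icc (-a) b).indicator (fun y => (y + a) * (2 * b - y)) (s + x) ≤
        (s + x + a) * (2 * b - (s + x)) := by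
      have : 0 ≤ (s + x + a) * (2 * b - (s + x)) :=
        mul_nonneg (by linarith [h.1]) (by linarith [h.2])
      rw [indicator_apply]
      split_ifs
      · exact le_rfl
      · exact this
    nlinarith
  · rw [indicator_of_notMem fun h' => h ⟨h'.1, by linarith [h'.2]⟩]
    have hx : a < |x| := by
      rw [mem_Icc, not_and_or, not_le, not_le] at h
      rcases h with h | h
      · exact lt_abs.2 (Or.inr (by linarith))
      · exact lt_abs.2 (Or.inl (by linarith))
    rw [indicator_of_mem (show x ∈ {y : ℝ | a < |y|} from hx)]
    have h1 : 0 ≤ (s + a) * (2 * b - s) := mul_nonneg (by linarith) (by linarith)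
    have h2 : |(2 * b - a - 2 * s) * x| ≤ 2 * b * |x| := by
      rw [abs_mul]
      gcongr
      exact abs_le.2 ⟨by linarith, by linarith⟩
    have h3 : 2 * b * |x| ≤ 2 * b / a * x ^ 2 := by
      rw [← sq_abs x, div_mul_eq_mul_div, le_div_iff₀ ha]
      nlinarith [abs_nonneg x, mul_nonneg (by linarith : 0 ≤ 2 * b) (abs_nonneg x)]
    nlinarith [neg_abs_le ((2 * b - a - 2 * s) * x)]

/-- One step of the potential from a nonpositive position. -/
theorem potential_step_nonpos {a b s x : ℝ} (hab : a ≤ b) (hs : s ≤ 0)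
    (hsa : -a ≤ s) (hx : 0 < x) :
    (Icc (-a) b).indicator (fun y => (y + a) * (2 * b - y)) (s + x) ≤
      (s + a) * (2 * b - s) + 3 * b * (Ioc 0 (2 * b)).indicator id x := by
  have hb : 0 ≤ b := by linarith
  have h1 : 0 ≤ (s + a) * (2 * b - s) := mul_nonneg (by linarith) (by linarith)
  have h2 : 0 ≤ 3 * b * (Ioc 0 (2 * b)).indicator id x :=
    mul_nonneg (by linarith) (indicator_nonneg (fun y hy => hy.1.le) x)
  rw [indicator_apply (Icc (-a) b)]
  split_ifs with h
  · rw [indicator_of_mem (show x ∈ Ioc 0 (2 * b) from ⟨hx, by linarith [h.2]⟩), id]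
    -- Since `-a ≤ s` and `a ≤ b`, the linear coefficient is at most `2b + a ≤ 3b`.
    nlinarith [mul_le_mul_of_nonneg_right (show 2 * b - a - 2 * s ≤ 3 * b by linarith) hx.le,
      sq_nonneg x]
  · linarith

theorem confinedPotential_nonneg (ha : 0 < a) (hab : a ≤ b) (ω : Ω) :
    0 ≤ confinedPotential ξ η a b k ω :=
  indicator_nonneg (fun ω hω => by
    have := hω k le_rfl
    exact mul_nonneg (by linarith [this.1]) (by linarith [this.2])) ω

theorem confinedPotential_succ_le (ha : 0 < a) (hab : a ≤ b) {ω : Ω} (hη : 0 < η k ω) :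
    confinedPotential ξ η a b (k + 1) ω ≤ confinedPotential ξ η a b k ω +
      (confinedPos ξ η a b k).indicator (fun ω => 2 * b - a - 2 * switchedWalk ξ η ω k) ω * ξ k ω -
      (confinedPos ξ η a b k).indicator 1 ω *
        (ξ k ω ^ 2 - (2 * b / a + 1) * {y : ℝ | a < |y|}.indicator (fun y => y ^ 2) (ξ k ω)) +
      (confinedNonpos ξ η a b k).indicator 1 ω *
        (3 * b * (Ioc 0 (2 * b)).indicator id (η k ω)) := by
  by_cases h : ω ∈ confined ξ η a b k
  · have hk := h k le_rfl
    have hV : confinedPotential ξ η a b (k + 1) ω =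
        (Icc (-a) b).indicator (fun y => (y + a) * (2 * b - y)) (switchedWalk ξ η ω (k + 1)) := by
      by_cases h1 : switchedWalk ξ η ω (k + 1) ∈ Icc (-a) b
      · rw [confinedPotential, indicator_of_mem (mem_confined_succ.2 ⟨h, h1⟩), indicator_of_mem h1]
      · rw [confinedPotential, indicator_of_notMem fun h' => h1 (mem_confined_succ.1 h').2,
          indicator_of_notMem h1]
    have hV' : confinedPotential ξ η a b k ω =
      (switchedWalk ξ η ω k + a) * (2 * b - switchedWalk ξ η ω k) := indicator_of_mem h _
    rw [hV, hV', switchedWalk]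
    split_ifs with hs
    · rw [indicator_of_mem (show ω ∈ confinedPos ξ η a b k from ⟨h, hs⟩),
        indicator_of_mem (show ω ∈ confinedPos ξ η a b k from ⟨h, hs⟩),
        indicator_of_notMem (show ω ∉ confinedNonpos ξ η a b k from fun h' => not_lt.2 h'.2 hs)]
      have := potential_step_pos (x := ξ k ω) ha hab hs hk.2
      simpa using this
    · rw [indicator_of_notMem (show ω ∉ confinedPos ξ η a b k from fun h' => hs h'.2),
        indicator_of_notMem (show ω ∉ confinedPos ξ η a b k from fun h' => hs h'.2),
        indicator_of_mem (show ω ∈ confinedNonpos ξ η a b k from ⟨h, not_lt.1 hs⟩)]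
      have := potential_step_nonpos hab (not_lt.1 hs) hk.1 hη
      simpa using this
  · have h1 : ω ∉ confined ξ η a b (k + 1) := fun h' => h (mem_confined_succ.1 h').1
    have h2 : ω ∉ confinedPos ξ η a b k := fun h' => h h'.1
    have h3 : ω ∉ confinedNonpos ξ η a b k := fun h' => h h'.1
    rw [confinedPotential, confinedPotential, indicator_of_notMem h, indicator_of_notMem h1,
      indicator_of_notMem h2, indicator_of_notMem h2, indicator_of_notMem h3]
    simp

/-- From a site at least `-a ≥ -b`, a jump above `2b` lands above `b`. -/
theorem indicator_confined_succ_le (hab : a ≤ b) (ω : Ω) :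
    (confined ξ η a b (k + 1)).indicator (1 : Ω → ℝ) ω ≤ (confined ξ η a b k).indicator 1 ω -
      (confinedNonpos ξ η a b k).indicator 1 ω * (Ioi (2 * b)).indicator 1 (η k ω) := by
  have hsub : confined ξ η a b (k + 1) ⊆ confined ξ η a b k := fun _ h => (mem_confined_succ.1 h).1
  by_cases h : ω ∈ confinedNonpos ξ η a b k
  · by_cases hb : 2 * b < η k ω
    · have : ω ∉ confined ξ η a b (k + 1) := by
        intro h'
        have h1 := (mem_confined_succ.1 h').2.2
        rw [switchedWalk, if_neg (not_lt.2 h.2)] at h1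
        linarith [(h.1 k le_rfl).1]
      rw [indicator_of_notMem this, indicator_of_mem h.1, indicator_of_mem h,
        indicator_of_mem (show η k ω ∈ Ioi (2 * b) from hb)]
      simp
    · rw [indicator_of_notMem (show η k ω ∉ Ioi (2 * b) from hb), mul_zero, sub_zero]
      exact indicator_le_indicator_of_subset hsub (fun _ => zero_le_one) ω
  · rw [indicator_of_notMem h, zero_mul, sub_zero]
    exact indicator_le_indicator_of_subset hsub (fun _ => zero_le_one) ω

end Confined

/-! ### Expectations of products of past and present -/

section IndepIntegral

variable {Ω : Type*} {m mΩ : MeasurableSpace Ω} {P : Measure Ω}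

theorem integral_mul_of_indep (hm : m ≤ mΩ) {X : Ω → ℝ}
    (hX : Measurable X) (h : Indep m (MeasurableSpace.comap X inferInstance) P) {Z : Ω → ℝ}
    (hZ : Measurable[m] Z) {f : ℝ → ℝ} (hf : Measurable f) :
    ∫ ω, Z ω * f (X ω) ∂P = (∫ ω, Z ω ∂P) * ∫ ω, f (X ω) ∂P := by
  have hi : IndepFun Z X P := indep_of_indep_of_le_left h hZ.comap_le
  exact (hi.comp measurable_id hf).integral_fun_mul_eq_mul_integral
    (hZ.mono hm le_rfl).aestronglyMeasurable (hf.comp hX).aestronglyMeasurable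

theorem integrable_mul_of_indep {X : Ω → ℝ}
    (h : Indep m (MeasurableSpace.comap X inferInstance) P) {Z : Ω → ℝ}
    (hZ : Measurable[m] Z) (hZi : Integrable Z P) {f : ℝ → ℝ} (hf : Measurable f)
    (hfi : Integrable (fun ω => f (X ω)) P) : Integrable (fun ω => Z ω * f (X ω)) P := by
  have hi : IndepFun Z X P := indep_of_indep_of_le_left h hZ.comap_le
  exact (hi.comp measurable_id hf).integrable_mul hZi hfi

theorem measurable_indicator_one {s : Set Ω} (hs : MeasurableSet s) :
    Measurable (s.indicator (1 : Ω → ℝ)) :=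
  measurable_one.indicator hs

end IndepIntegral

/-! ### Expected time spent in the band -/

section ConfinedIntegral

variable {Ω : Type*} {mΩ : MeasurableSpace Ω} {P : Measure Ω} [IsProbabilityMeasure P]

theorem integrable_of_bounded {Z : Ω → ℝ} (hZ : Measurable Z) {C : ℝ} (h : ∀ ω, |Z ω| ≤ C) :
    Integrable Z P :=
  Integrable.of_bound hZ.aestronglyMeasurable C (ae_of_all _ h)

variable {ξ η : ℕ → Ω → ℝ} {a b : ℝ}

theorem measurable_switchedWalk_pastSigma_indicator (ξ η : ℕ → Ω → ℝ) (k : ℕ) {s : Set Ω}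
    (hs : MeasurableSet[pastSigma ξ η k] s) {f : ℝ → ℝ} (hf : Measurable f) :
    Measurable[pastSigma ξ η k] (s.indicator fun ω => f (switchedWalk ξ η ω k)) := by
  let _ := pastSigma ξ η k
  exact (hf.comp (measurable_pastSigma_switchedWalk ξ η le_rfl)).indicator hs

theorem integrable_confined_indicator (hξ : ∀ n, Measurable (ξ n)) (hη : ∀ n, Measurable (η n))
    {k : ℕ} {s : Set Ω} (hs : MeasurableSet s) (hsc : s ⊆ confined ξ η a b k) {f : ℝ → ℝ}
    (hf : Continuous f) :
    Integrable (s.indicator fun ω => f (switchedWalk ξ η ω k)) P := by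
  obtain ⟨C, hC⟩ := (isCompact_Icc (a := -a) (b := b)).exists_bound_of_continuousOn hf.continuousOn
  refine integrable_of_bounded
    ((hf.measurable.comp (measurable_switchedWalk hξ hη k)).indicator hs) (C := max C 0) fun ω => ?_
  by_cases h : ω ∈ s
  · rw [indicator_of_mem h]
    exact (hC _ (hsc h k le_rfl)).trans (le_max_left _ _)
  · rw [indicator_of_notMem h, abs_zero]
    exact le_max_right _ _

/-- Expectation of the pathwise step bound. The increments at time `k` are independent of the past:
the linear term vanishes because `ξ` is centred, and `hsmall` leaves at least half of the variance
as downward drift. -/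
theorem integral_confinedPotential_succ_le (hξ : ∀ n, Measurable (ξ n))
    (hη : ∀ n, Measurable (η n)) (hξ_indep : iIndepFun ξ P)
    (hξ_ident : ∀ n, IdentDistrib (ξ n) (ξ 0) P P) (hη_indep : iIndepFun η P)
    (hη_ident : ∀ n, IdentDistrib (η n) (η 0) P P)
    (hξη : IndepFun (fun ω n => ξ n ω) (fun ω n => η n ω) P) {σ : ℝ}
    (hξ_L2 : MemLp (ξ 0) 2 P) (hξ_mean : ∫ ω, ξ 0 ω ∂P = 0)
    (hξ_var : ∫ ω, ξ 0 ω ^ 2 ∂P = σ ^ 2) (hη_pos : ∀ n, ∀ᵐ ω ∂P, 0 < η n ω)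
    (ha : 0 < a) (hab : a ≤ b)
    (hsmall : (2 * b / a + 1) * ∫ ω, {y : ℝ | a < |y|}.indicator (fun y => y ^ 2) (ξ 0 ω) ∂P ≤
      σ ^ 2 / 2) (k : ℕ) :
    ∫ ω, confinedPotential ξ η a b (k + 1) ω ∂P ≤ ∫ ω, confinedPotential ξ η a b k ω ∂P -
      σ ^ 2 / 2 * P.real (confinedPos ξ η a b k) +
      3 * b * (∫ ω, (Ioc 0 (2 * b)).indicator id (η 0 ω) ∂P) *
        P.real (confinedNonpos ξ η a b k) := by
  have hle := pastSigma_le hξ hη k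
  have hIξ := indep_pastSigma_left hξ hη hξ_indep hξη k
  have hIη := indep_pastSigma_right hξ hη hη_indep hξη k
  have hpos := measurableSet_pastSigma_confinedPos ξ η a b k
  have hnon := measurableSet_pastSigma_confinedNonpos ξ η a b k
  have htr : Measurable ({y : ℝ | a < |y|}.indicator fun y : ℝ => y ^ 2) :=
    (by fun_prop : Measurable fun y : ℝ => y ^ 2).indicator
      (measurableSet_lt measurable_const (by fun_prop))
  set f : ℝ → ℝ := fun x =>
    x ^ 2 - (2 * b / a + 1) * {y : ℝ | a < |y|}.indicator (fun y => y ^ 2) x with hf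
  have hfm : Measurable f := (by fun_prop : Measurable fun y : ℝ => y ^ 2).sub (htr.const_mul _)
  set g : ℝ → ℝ := fun x => 3 * b * (Ioc 0 (2 * b)).indicator id x with hg
  have hgm : Measurable g := (measurable_id.indicator measurableSet_Ioc).const_mul _
  have hsq : Integrable (fun ω => ξ 0 ω ^ 2) P := hξ_L2.integrable_sq
  have htri : Integrable (fun ω => {y : ℝ | a < |y|}.indicator (fun y : ℝ => y ^ 2) (ξ 0 ω)) P := by
    refine hsq.mono' (htr.comp (hξ 0)).aestronglyMeasurable (ae_of_all _ fun ω => ?_)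
    rw [Real.norm_of_nonneg (indicator_nonneg (fun y _ => sq_nonneg y) _)]
    exact indicator_le_self' (fun y _ => sq_nonneg y) _
  have hξ1 : Integrable (ξ k) P :=
    (hξ_ident k).integrable_iff.2 (hξ_L2.integrable (by norm_num))
  have hfi : Integrable (fun ω => f (ξ k ω)) P :=
    ((hξ_ident k).comp hfm).integrable_iff.2 (hsq.sub (htri.const_mul _))
  have hgi : Integrable (fun ω => g (η k ω)) P := by
    refine integrable_of_bounded (hgm.comp (hη k)) (C := |3 * b| * |2 * b|) fun ω => ?_
    rw [hg, abs_mul]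
    refine mul_le_mul_of_nonneg_left ?_ (abs_nonneg _)
    by_cases h : η k ω ∈ Ioc 0 (2 * b)
    · rw [indicator_of_mem h, id]
      exact abs_le_abs_of_nonneg h.1.le h.2
    · rw [indicator_of_notMem h, abs_zero]
      positivity
  have hone : ∀ s, MeasurableSet[pastSigma ξ η k] s →
      Measurable[pastSigma ξ η k] (s.indicator (1 : Ω → ℝ)) := fun s hs =>
    measurable_indicator_one hs
  have honei : ∀ s, MeasurableSet[pastSigma ξ η k] s → Integrable (s.indicator (1 : Ω → ℝ)) P :=
    fun s hs => (integrable_const (1 : ℝ)).indicator (hle s hs)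
  have hlin := measurable_switchedWalk_pastSigma_indicator ξ η k hpos
    (f := fun s => 2 * b - a - 2 * s) (by fun_prop)
  have hlini := integrable_confined_indicator (P := P) (f := fun s => 2 * b - a - 2 * s) hξ hη
    (hle _ hpos) inter_subset_left (by fun_prop)
  have hV : ∀ k, Integrable (confinedPotential ξ η a b k) P := fun k =>
    integrable_confined_indicator (f := fun s => (s + a) * (2 * b - s)) hξ hη
      (pastSigma_le hξ hη k _ (measurableSet_pastSigma_confined ξ η a b k)) Subset.rfl (by fun_prop)
  have i1 := integrable_mul_of_indep hIξ hlin hlini measurable_id hξ1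
  have i2 := integrable_mul_of_indep hIξ (hone _ hpos) (honei _ hpos) hfm hfi
  have i3 := integrable_mul_of_indep hIη (hone _ hnon) (honei _ hnon) hgm hgi
  have e1 := integral_mul_of_indep hle (hξ k) hIξ hlin measurable_id
  have e2 := integral_mul_of_indep hle (hξ k) hIξ (hone _ hpos) hfm
  have e3 := integral_mul_of_indep hle (hη k) hIη (hone _ hnon) hgm
  have hmean : ∫ ω, id (ξ k ω) ∂P = 0 := (hξ_ident k).integral_eq.trans hξ_mean
  have hfk : ∫ ω, f (ξ k ω) ∂P = σ ^ 2 - (2 * b / a + 1) *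
      ∫ ω, {y : ℝ | a < |y|}.indicator (fun y => y ^ 2) (ξ 0 ω) ∂P := by
    refine ((hξ_ident k).comp hfm).integral_eq.trans ?_
    simp only [hf, Function.comp_apply]
    rw [integral_sub hsq (htri.const_mul _), integral_const_mul, hξ_var]
  have hgk : ∫ ω, g (η k ω) ∂P = 3 * b * ∫ ω, (Ioc 0 (2 * b)).indicator id (η 0 ω) ∂P :=
    ((hη_ident k).comp hgm).integral_eq.trans (integral_const_mul _ _)
  have hmono : ∫ ω, confinedPotential ξ η a b (k + 1) ω ∂P ≤
      ∫ ω, (confinedPotential ξ η a b k ω +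
        (confinedPos ξ η a b k).indicator (fun ω => 2 * b - a - 2 * switchedWalk ξ η ω k) ω *
          id (ξ k ω) - (confinedPos ξ η a b k).indicator 1 ω * f (ξ k ω) +
        (confinedNonpos ξ η a b k).indicator 1 ω * g (η k ω)) ∂P := by
    refine integral_mono_ae (hV _) ((((hV k).add i1).sub i2).add i3) ?_
    filter_upwards [hη_pos k] with ω hω
    exact confinedPotential_succ_le ha hab hω
  refine hmono.trans ?_
  refine (integral_add (((hV k).add i1).sub i2) i3).le.trans ?_
  rw [integral_sub' ((hV k).add i1) i2, integral_add' (hV k) i1, e1, e2, e3, hmean, hfk, hgk, integral_indicator_one (hle _ hpos),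
    integral_indicator_one (hle _ hnon)]
  have : 0 ≤ P.real (confinedPos ξ η a b k) := measureReal_nonneg
  nlinarith [mul_le_mul_of_nonneg_left hsmall this]

theorem measureReal_confined_succ_le (hξ : ∀ n, Measurable (ξ n))
    (hη : ∀ n, Measurable (η n)) (hη_indep : iIndepFun η P)
    (hη_ident : ∀ n, IdentDistrib (η n) (η 0) P P)
    (hξη : IndepFun (fun ω n => ξ n ω) (fun ω n => η n ω) P) (hab : a ≤ b) (k : ℕ) :
    P.real (confined ξ η a b (k + 1)) ≤ P.real (confined ξ η a b k) -
      P.real {ω | 2 * b < η 0 ω} * P.real (confinedNonpos ξ η a b k) := by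
  have hle := pastSigma_le hξ hη k
  have hIη := indep_pastSigma_right hξ hη hη_indep hξη k
  have hnon := measurableSet_pastSigma_confinedNonpos ξ η a b k
  have hc : ∀ k, MeasurableSet (confined ξ η a b k) := fun k =>
    pastSigma_le hξ hη k _ (measurableSet_pastSigma_confined ξ η a b k)
  have hone : Measurable[pastSigma ξ η k] ((confinedNonpos ξ η a b k).indicator (1 : Ω → ℝ)) :=
    measurable_indicator_one hnon
  have hi : ∀ s : Set Ω, MeasurableSet s → Integrable (s.indicator (1 : Ω → ℝ)) P :=
    fun s hs => (integrable_const (1 : ℝ)).indicator hs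
  have hgm : Measurable ((Ioi (2 * b)).indicator (1 : ℝ → ℝ)) :=
    measurable_one.indicator measurableSet_Ioi
  have hηs : MeasurableSet {ω | 2 * b < η k ω} := measurableSet_lt measurable_const (hη k)
  have i1 := integrable_mul_of_indep hIη hone (hi _ (hle _ hnon)) hgm (hi _ hηs)
  have e1 := integral_mul_of_indep hle (hη k) hIη hone hgm
  have hη0 : ∫ ω, (Ioi (2 * b)).indicator (1 : ℝ → ℝ) (η k ω) ∂P = P.real {ω | 2 * b < η 0 ω} := by
    refine ((hη_ident k).comp hgm).integral_eq.trans ?_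
    exact integral_indicator_one (measurableSet_lt measurable_const (hη 0))
  have hmono := integral_mono (hi _ (hc (k + 1))) ((hi _ (hc k)).sub i1)
    (indicator_confined_succ_le (ξ := ξ) (η := η) hab)
  simp only [Pi.sub_apply] at hmono
  rw [integral_sub (hi _ (hc k)) i1, e1, hη0, integral_indicator_one (hc _),
    integral_indicator_one (hc _), integral_indicator_one (hle _ hnon)] at hmono
  linarith

/-- Each confined nonpositive visit costs the fraction `P(η > 2b)` of its probability; the losses
telescope and cannot exceed `1`. -/
theorem sum_measureReal_confinedNonpos_le (hξ : ∀ n, Measurable (ξ n))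
    (hη : ∀ n, Measurable (η n)) (hη_indep : iIndepFun η P)
    (hη_ident : ∀ n, IdentDistrib (η n) (η 0) P P)
    (hξη : IndepFun (fun ω n => ξ n ω) (fun ω n => η n ω) P) (hab : a ≤ b) (m : ℕ) :
    P.real {ω | 2 * b < η 0 ω} * ∑ k ∈ Finset.range m, P.real (confinedNonpos ξ η a b k) ≤ 1 := by
  have h : ∀ m, P.real {ω | 2 * b < η 0 ω} *
      ∑ k ∈ Finset.range m, P.real (confinedNonpos ξ η a b k) ≤
        1 - P.real (confined ξ η a b m) := by
    intro m
    induction m with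
    | zero => simp
    | succ m ih =>
      have := measureReal_confined_succ_le hξ hη hη_indep hη_ident hξη hab m
      rw [Finset.sum_range_succ, mul_add]
      linarith
  linarith [h m, measureReal_nonneg (μ := P) (s := confined ξ η a b m)]

/-- The probability that the walk is confined to `[-a, b]` up to time `m`. -/
theorem mul_measureReal_confined_le (hξ : ∀ n, Measurable (ξ n))
    (hη : ∀ n, Measurable (η n)) (hξ_indep : iIndepFun ξ P)
    (hξ_ident : ∀ n, IdentDistrib (ξ n) (ξ 0) P P) (hη_indep : iIndepFun η P)
    (hη_ident : ∀ n, IdentDistrib (η n) (η 0) P P)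
    (hξη : IndepFun (fun ω n => ξ n ω) (fun ω n => η n ω) P) {σ : ℝ} (hσ : 0 < σ)
    (hξ_L2 : MemLp (ξ 0) 2 P) (hξ_mean : ∫ ω, ξ 0 ω ∂P = 0)
    (hξ_var : ∫ ω, ξ 0 ω ^ 2 ∂P = σ ^ 2) (hη_pos : ∀ n, ∀ᵐ ω ∂P, 0 < η n ω)
    (ha : 0 < a) (hab : a ≤ b)
    (hsmall : (2 * b / a + 1) * ∫ ω, {y : ℝ | a < |y|}.indicator (fun y => y ^ 2) (ξ 0 ω) ∂P ≤
      σ ^ 2 / 2) (hG : 0 < P.real {ω | 2 * b < η 0 ω}) (m : ℕ) :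
    m * P.real (confined ξ η a b m) ≤
      2 / σ ^ 2 * (2 * a * b + 3 * b * ((∫ ω, (Ioc 0 (2 * b)).indicator id (η 0 ω) ∂P) /
        P.real {ω | 2 * b < η 0 ω})) + 1 / P.real {ω | 2 * b < η 0 ω} := by
  set G := P.real {ω | 2 * b < η 0 ω}
  set M := ∫ ω, (Ioc 0 (2 * b)).indicator id (η 0 ω) ∂P
  have hM : 0 ≤ M := integral_nonneg fun ω => indicator_nonneg (fun y hy => hy.1.le) _
  have hN : ∑ k ∈ Finset.range m, P.real (confinedNonpos ξ η a b k) ≤ 1 / G := by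
    rw [le_div_iff₀' hG]
    exact sum_measureReal_confinedNonpos_le hξ hη hη_indep hη_ident hξη hab m
  have hpot : ∀ m, σ ^ 2 / 2 * ∑ k ∈ Finset.range m, P.real (confinedPos ξ η a b k) +
      ∫ ω, confinedPotential ξ η a b m ω ∂P ≤
        2 * a * b + 3 * b * M * ∑ k ∈ Finset.range m, P.real (confinedNonpos ξ η a b k) := by
    intro m
    induction m with
    | zero =>
      have h0 : confinedPotential ξ η a b 0 = fun _ => 2 * a * b := by
        funext ω
        have : ω ∈ confined ξ η a b 0 := by
          intro j hj
          rw [Nat.le_zero.1 hj, switchedWalk]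
          exact ⟨by linarith, by linarith⟩
        rw [confinedPotential, indicator_of_mem this, switchedWalk]
        ring
      simp [h0]
    | succ m ih =>
      have := integral_confinedPotential_succ_le hξ hη hξ_indep hξ_ident hη_indep hη_ident hξη
        hξ_L2 hξ_mean hξ_var hη_pos ha hab hsmall m
      rw [Finset.sum_range_succ, Finset.sum_range_succ, mul_add, mul_add]
      linarith
  have hb : 0 ≤ b := by linarith
  have hpos : ∑ k ∈ Finset.range m, P.real (confinedPos ξ η a b k) ≤
      2 / σ ^ 2 * (2 * a * b + 3 * b * (M / G)) := by
    have h1 := hpot m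
    have h2 : 0 ≤ ∫ ω, confinedPotential ξ η a b m ω ∂P :=
      integral_nonneg fun ω => confinedPotential_nonneg ha hab ω
    have h3 := mul_le_mul_of_nonneg_left hN (show 0 ≤ 3 * b * M by positivity)
    have h4 : 3 * b * M * (1 / G) = 3 * b * (M / G) := by ring
    rw [div_mul_eq_mul_div, le_div_iff₀ (by positivity)]
    linarith
  -- Confinement up to `m` implies confinement up to each `k < m`, so `m` times its probability is
  -- at most the expected occupation time.
  have hc : ∀ k ∈ Finset.range m, P.real (confined ξ η a b m) ≤
      P.real (confinedPos ξ η a b k) + P.real (confinedNonpos ξ η a b k) := by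
    intro k hk
    refine (measureReal_mono ?_).trans (measureReal_union_le _ _)
    intro ω hω
    have h1 : ω ∈ confined ξ η a b k := fun j hj => hω j (hj.trans (Finset.mem_range.1 hk).le)
    rcases lt_or_ge 0 (switchedWalk ξ η ω k) with h | h
    · exact Or.inl ⟨h1, h⟩
    · exact Or.inr ⟨h1, h⟩
  have := Finset.sum_le_sum hc
  rw [Finset.sum_const, Finset.card_range, nsmul_eq_mul, Finset.sum_add_distrib] at this
  linarith

end ConfinedIntegral

/-! ### Tails and truncated moments -/

section TailOfRandomVariable

variable {Ω : Type*} {mΩ : MeasurableSpace Ω} {P : Measure Ω}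

theorem sq_mul_measureReal_lt_abs_le {X : Ω → ℝ} (hX : Measurable X) (hX2 : MemLp X 2 P) {a : ℝ}
    (ha : 0 ≤ a) : a ^ 2 * P.real {ω | a < |X ω|} ≤
      ∫ ω, {y : ℝ | a < |y|}.indicator (fun y => y ^ 2) (X ω) ∂P := by
  have hs : MeasurableSet {ω | a < |X ω|} := measurableSet_lt measurable_const hX.abs
  rw [← integral_indicator_one hs, ← integral_const_mul]
  refine integral_mono_of_nonneg (ae_of_all _ fun ω =>
    mul_nonneg (sq_nonneg a) (indicator_nonneg (fun _ _ => zero_le_one) _))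
    (hX2.integrable_sq.indicator hs) (ae_of_all _ fun ω => ?_)
  by_cases h : a < |X ω|
  · have h1 : a ^ 2 ≤ X ω ^ 2 := by
      rw [← sq_abs (X ω)]
      gcongr
    simpa [indicator, h] using h1
  · simp [indicator, h]

theorem tendsto_measureReal_tail_div {Y : Ω → ℝ} {l : ℝ → ℝ} (hl : IsSlowlyVarying l)
    (h : Asymptotics.IsEquivalent atTop (fun x : ℝ => P.real {ω | x < Y ω}) l) :
    Tendsto (fun x => P.real {ω | 2 * x < Y ω} / P.real {ω | x < Y ω}) atTop (𝓝 1) := by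
  obtain ⟨⟨A, -, hA⟩, hr⟩ := hl
  have h2 : Tendsto (fun x : ℝ => 2 * x) atTop atTop := tendsto_id.const_mul_atTop two_pos
  have h3 : Asymptotics.IsEquivalent atTop
      (fun x => P.real {ω | 2 * x < Y ω} / P.real {ω | x < Y ω}) (fun x => l (2 * x) / l x) :=
    (h.comp_tendsto h2).div h
  exact h3.symm.tendsto_nhds (hr 2 two_pos)

theorem tendsto_integral_indicator_sq_atTop {X : Ω → ℝ} (hX : Measurable X) (hX2 : MemLp X 2 P) :
    Tendsto (fun a : ℝ => ∫ ω, {y : ℝ | a < |y|}.indicator (fun y => y ^ 2) (X ω) ∂P)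
      atTop (𝓝 0) := by
  have h := tendsto_integral_filter_of_dominated_convergence (μ := P) (l := (atTop : Filter ℝ))
    (F := fun a ω => {y : ℝ | a < |y|}.indicator (fun y => y ^ 2) (X ω)) (f := fun _ => 0)
    (fun ω => X ω ^ 2) (Eventually.of_forall fun a => ?_)
    (Eventually.of_forall fun a => ae_of_all _ fun ω => ?_) hX2.integrable_sq
    (ae_of_all _ fun ω => ?_)
  · simpa using h
  · exact (((by fun_prop : Measurable fun y : ℝ => y ^ 2).indicator
      (measurableSet_lt measurable_const (by fun_prop))).comp hX).aestronglyMeasurable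
  · rw [Real.norm_of_nonneg (indicator_nonneg (fun y _ => sq_nonneg y) _)]
    exact indicator_le_self' (fun y _ => sq_nonneg y) _
  · refine tendsto_nhds_of_eventually_eq ?_
    filter_upwards [eventually_ge_atTop |X ω|] with a ha
    exact indicator_of_notMem (show X ω ∉ {y : ℝ | a < |y|} from not_lt.2 ha) _

variable [IsProbabilityMeasure P]

theorem integrable_indicator_Ioc {Y : Ω → ℝ} (hY : Measurable Y) (x : ℝ) :
    Integrable (fun ω => (Ioc 0 x).indicator id (Y ω)) P := by
  refine integrable_of_bounded ((measurable_id.indicator measurableSet_Ioc).comp hY) (C := |x|)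
    fun ω => ?_
  by_cases h : Y ω ∈ Ioc 0 x
  · rw [indicator_of_mem h, id]
    exact abs_le_abs_of_nonneg h.1.le h.2
  · rw [indicator_of_notMem h, abs_zero]
    exact abs_nonneg x

theorem indicator_Ioc_id_mono {x y : ℝ} (hxy : x ≤ y) (z : ℝ) :
    (Ioc 0 x).indicator id z ≤ (Ioc 0 y).indicator id z := by
  by_cases h : z ∈ Ioc 0 x
  · rw [indicator_of_mem h, indicator_of_mem (Ioc_subset_Ioc_right hxy h)]
  · rw [indicator_of_notMem h]
    exact indicator_nonneg (fun w hw => hw.1.le) z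

theorem monotone_integral_indicator_Ioc {Y : Ω → ℝ} (hY : Measurable Y) :
    Monotone fun x => ∫ ω, (Ioc 0 x).indicator id (Y ω) ∂P := fun _ y hxy =>
  integral_mono_of_nonneg (ae_of_all _ fun _ => indicator_nonneg (fun _ hz => hz.1.le) _)
    (integrable_indicator_Ioc hY y) (ae_of_all _ fun ω =>
      indicator_Ioc_id_mono hxy (Y ω))

/-- On `x < Y ≤ 2x` the integrand is at most `2x`. -/
theorem integral_indicator_Ioc_two_mul_le {Y : Ω → ℝ} (hY : Measurable Y) {x : ℝ} (hx : 0 < x) :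
    ∫ ω, (Ioc 0 (2 * x)).indicator id (Y ω) ∂P ≤ ∫ ω, (Ioc 0 x).indicator id (Y ω) ∂P +
      2 * x * (P.real {ω | x < Y ω} - P.real {ω | 2 * x < Y ω}) := by
  have hs : ∀ z, MeasurableSet {ω | z < Y ω} := fun z => measurableSet_lt measurable_const hY
  have hi : ∀ z, Integrable ({ω | z < Y ω}.indicator (1 : Ω → ℝ)) P := fun z =>
    (integrable_const (1 : ℝ)).indicator (hs z)
  have hle : ∀ ω, (Ioc 0 (2 * x)).indicator id (Y ω) ≤ (Ioc 0 x).indicator id (Y ω) +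
      2 * x * ({ω | x < Y ω}.indicator 1 ω - {ω | 2 * x < Y ω}.indicator 1 ω) := by
    intro ω
    simp only [indicator, mem_Ioc, mem_ofPred_eq, id, Pi.one_apply]
    split_ifs <;> first | linarith | (exfalso; grind)
  have := integral_mono (integrable_indicator_Ioc (P := P) hY (2 * x))
    ((integrable_indicator_Ioc hY x).add (((hi x).sub (hi (2 * x))).const_mul (2 * x))) hle
  refine this.trans (le_of_eq ?_)
  refine (integral_add (integrable_indicator_Ioc hY x)
    (((hi x).sub (hi (2 * x))).const_mul (2 * x))).trans ?_
  rw [integral_const_mul, integral_sub' (hi x) (hi (2 * x)), integral_indicator_one (hs _),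
    integral_indicator_one (hs _)]

theorem measureReal_tail_pos {Y : Ω → ℝ} {l : ℝ → ℝ} (hl : ∃ A : ℝ, ∀ x ∈ Ici A, 0 < l x)
    (h : Asymptotics.IsEquivalent atTop (fun x : ℝ => P.real {ω | x < Y ω}) l) (x : ℝ) :
    0 < P.real {ω | x < Y ω} := by
  obtain ⟨A, hA⟩ := hl
  obtain ⟨φ, hφ, he⟩ := h.exists_eq_mul
  obtain ⟨y, hy, hy1, hyA, hyx⟩ := (he.and ((hφ.eventually (lt_mem_nhds one_pos)).and
    ((eventually_ge_atTop A).and (eventually_ge_atTop x)))).exists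
  have h1 : 0 < P.real {ω | y < Y ω} := by
    exact (mul_pos hy1 (hA y hyA)).trans_eq hy.symm
  exact h1.trans_le (measureReal_mono fun ω hω => lt_of_le_of_lt hyx hω)

end TailOfRandomVariable

/-! ### Leaving a band of width of order `√n` -/

section LeavingBands

variable {Ω : Type*} {mΩ : MeasurableSpace Ω} {P : Measure Ω} [IsProbabilityMeasure P]
  {ξ η : ℕ → Ω → ℝ}

theorem neg_le_switchedWalk {Ω : Type*} {ξ η : ℕ → Ω → ℝ} {a : ℝ} (ha : 0 ≤ a) {ω : Ω} {m : ℕ}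
    (hη : ∀ j, 0 < η j ω) (hξ : ∀ j < m, -a ≤ ξ j ω) :
    ∀ j ≤ m, -a ≤ switchedWalk ξ η ω j := by
  intro j
  induction j with
  | zero => exact fun _ => by rw [switchedWalk]; linarith
  | succ j ih =>
    intro hj
    have h1 := ih (by omega)
    have h2 := hξ j (by omega)
    have h3 := hη j
    rw [switchedWalk]
    split_ifs <;> linarith

/-- A walk below `b` is either confined or has crossed `-a`, almost surely through some `ξ_j < -a`.
Chebyshev's bound keeps the truncated second moment, so the union bound is still `o(1)` when `m` is
of order `a²`. -/
theorem measureReal_forall_le_le (hξ : ∀ n, Measurable (ξ n))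
    (hξ_ident : ∀ n, IdentDistrib (ξ n) (ξ 0) P P) (hξ_L2 : MemLp (ξ 0) 2 P)
    (hη_pos : ∀ n, ∀ᵐ ω ∂P, 0 < η n ω) {a b : ℝ} (ha : 0 < a) (m : ℕ) :
    P.real {ω | ∀ j ≤ m, switchedWalk ξ η ω j ≤ b} ≤ P.real (confined ξ η a b m) +
      m * ((∫ ω, {y : ℝ | a < |y|}.indicator (fun y => y ^ 2) (ξ 0 ω) ∂P) / a ^ 2) := by
  have hnull : P.real {ω | ¬ ∀ j, 0 < η j ω} = 0 := by
    rw [measureReal_eq_zero_iff]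
    exact ae_all_iff.2 hη_pos
  have hsub : {ω | ∀ j ≤ m, switchedWalk ξ η ω j ≤ b} ⊆
      (confined ξ η a b m ∪ ⋃ j ∈ Finset.range m, {ω | a < |ξ j ω|}) ∪
        {ω | ¬ ∀ j, 0 < η j ω} := by
    intro ω hω
    by_cases h1 : ∀ j, 0 < η j ω
    · left
      by_cases h2 : ∀ j < m, -a ≤ ξ j ω
      · exact Or.inl fun j hj => ⟨neg_le_switchedWalk ha.le h1 h2 j hj, hω j hj⟩
      · push Not at h2
        obtain ⟨j, hj, hja⟩ := h2
        refine Or.inr (mem_biUnion (Finset.mem_coe.2 (Finset.mem_range.2 hj)) ?_)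
        exact lt_abs.2 (Or.inr (lt_neg_of_lt_neg hja))
    · exact Or.inr h1
  have hj : ∀ j, P.real {ω | a < |ξ j ω|} ≤
      (∫ ω, {y : ℝ | a < |y|}.indicator (fun y => y ^ 2) (ξ 0 ω) ∂P) / a ^ 2 := by
    intro j
    have hm : MeasurableSet {y : ℝ | a < |y|} := measurableSet_lt measurable_const (by fun_prop)
    have h1 : P.real {ω | a < |ξ j ω|} = P.real {ω | a < |ξ 0 ω|} :=
      congrArg ENNReal.toReal ((hξ_ident j).measure_mem_eq hm)
    rw [h1, le_div_iff₀' (by positivity)]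
    exact sq_mul_measureReal_lt_abs_le (hξ 0) hξ_L2 ha.le
  calc P.real {ω | ∀ j ≤ m, switchedWalk ξ η ω j ≤ b}
      ≤ P.real (confined ξ η a b m ∪ ⋃ j ∈ Finset.range m, {ω | a < |ξ j ω|}) +
        P.real {ω | ¬ ∀ j, 0 < η j ω} := (measureReal_mono hsub).trans (measureReal_union_le _ _)
    _ ≤ P.real (confined ξ η a b m) + ∑ j ∈ Finset.range m, P.real {ω | a < |ξ j ω|} := by
        rw [hnull, add_zero]
        exact (measureReal_union_le _ _).trans
          (add_le_add le_rfl (measureReal_biUnion_finset_le _ _))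
    _ ≤ _ := by
        refine add_le_add le_rfl ((Finset.sum_le_sum fun j _ => hj j).trans ?_)
        rw [Finset.sum_const, Finset.card_range, nsmul_eq_mul]

theorem tendsto_measureReal_forall_le (hξ : ∀ n, Measurable (ξ n))
    (hη : ∀ n, Measurable (η n)) (hξ_indep : iIndepFun ξ P)
    (hξ_ident : ∀ n, IdentDistrib (ξ n) (ξ 0) P P) (hη_indep : iIndepFun η P)
    (hη_ident : ∀ n, IdentDistrib (η n) (η 0) P P)
    (hξη : IndepFun (fun ω n => ξ n ω) (fun ω n => η n ω) P) {σ : ℝ} (hσ : 0 < σ)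
    (hξ_L2 : MemLp (ξ 0) 2 P) (hξ_mean : ∫ ω, ξ 0 ω ∂P = 0)
    (hξ_var : ∫ ω, ξ 0 ω ^ 2 ∂P = σ ^ 2) (hη_pos : ∀ n, ∀ᵐ ω ∂P, 0 < η n ω)
    {l : ℝ → ℝ} (hl : IsSlowlyVarying l)
    (hη_tail : Asymptotics.IsEquivalent atTop (fun x : ℝ => P.real {ω | x < η 0 ω}) l)
    {t B : ℝ} (ht : 0 < t) (hB : 0 < B) :
    Tendsto (fun n : ℕ => P.real {ω | ∀ j ≤ ⌊n * t⌋₊, switchedWalk ξ η ω j ≤ B * √n})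
      atTop (𝓝 0) := by
  set G : ℝ → ℝ := fun x => P.real {ω | x < η 0 ω} with hGdef
  set M : ℝ → ℝ := fun x => ∫ ω, (Ioc 0 x).indicator id (η 0 ω) ∂P with hMdef
  set T : ℝ → ℝ := fun a => ∫ ω, {y : ℝ | a < |y|}.indicator (fun y => y ^ 2) (ξ 0 ω) ∂P with hTdef
  have hGpos : ∀ x, 0 < G x :=
    measureReal_tail_pos (hl.1.imp fun A hA => hA.2) hη_tail
  have hGanti : Antitone G := fun x y hxy => measureReal_mono fun ω hω => lt_of_le_of_lt hxy hω
  have hGdiv : Tendsto (fun x => G (2 * x) / G x) atTop (𝓝 1) :=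
    tendsto_measureReal_tail_div hl hη_tail
  have hM0 : ∀ x, 0 ≤ M x := fun x => integral_nonneg fun ω => indicator_nonneg (fun y hy => hy.1.le) _
  have hr := tendsto_div_mul_self_of_tendsto_div hGpos hGanti hGdiv hM0
    (monotone_integral_indicator_Ioc (hη 0)) (fun x hx => integral_indicator_Ioc_two_mul_le (hη 0) hx)
  have hh := (tendsto_mul_self_atTop_of_tendsto_div hGpos hGanti hGdiv).inv_tendsto_atTop
  have hT := tendsto_integral_indicator_sq_atTop (hξ 0) hξ_L2
  have hsqrt : Tendsto (fun n : ℕ => √(n : ℝ)) atTop atTop :=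
    Real.tendsto_sqrt_atTop.comp tendsto_natCast_atTop_atTop
  have hx : Tendsto (fun n : ℕ => 2 * (B * √(n : ℝ))) atTop atTop :=
    (hsqrt.const_mul_atTop hB).const_mul_atTop two_pos
  -- `Kδ` is the contribution of the initial potential `2ab`, with `a = δb`, after division by
  -- `nt/2`; it is the only term not vanishing as `n → ∞`.
  set K := 8 * B ^ 2 / (σ ^ 2 * t) with hK
  have hKpos : 0 < K := by positivity
  rw [Metric.tendsto_atTop]
  intro ε hε
  set δ := min 1 (ε / (2 * K)) with hδ
  have hδ0 : 0 < δ := by positivity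
  have hδ1 : δ ≤ 1 := min_le_left _ _
  have hKδ : K * δ ≤ ε / 2 := by
    calc K * δ ≤ K * (ε / (2 * K)) := by gcongr; exact min_le_right _ _
      _ = ε / 2 := by field_simp
  have ha : Tendsto (fun n : ℕ => δ * (B * √(n : ℝ))) atTop atTop :=
    (hsqrt.const_mul_atTop hB).const_mul_atTop hδ0
  have hrem : Tendsto (fun n : ℕ => 24 * B ^ 2 / (σ ^ 2 * t) *
        (M (2 * (B * √n)) / (2 * (B * √n) * G (2 * (B * √n)))) +
      8 * B ^ 2 / t * (2 * (B * √n) * G (2 * (B * √n)))⁻¹ +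
      t / (δ * B) ^ 2 * T (δ * (B * √n))) atTop (𝓝 0) := by
    have := (((hr.comp hx).const_mul (24 * B ^ 2 / (σ ^ 2 * t))).add
      ((hh.comp hx).const_mul (8 * B ^ 2 / t))).add ((hT.comp ha).const_mul (t / (δ * B) ^ 2))
    simpa using this
  -- With `a = δb` the ratio `2b/a` is the constant `2/δ`, so the truncated moment makes the product
  -- vanish.
  have hsm : ∀ᶠ n : ℕ in atTop, (2 / δ + 1) * T (δ * (B * √n)) ≤ σ ^ 2 / 2 := by
    have := (hT.comp ha).const_mul (2 / δ + 1)
    rw [mul_zero] at this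
    exact this.eventually_le_const (by positivity)
  rw [← eventually_atTop]
  filter_upwards [hrem.eventually_lt_const (half_pos hε), hsm, eventually_gt_atTop 0,
    hx.eventually_ge_atTop 1,
    tendsto_natCast_atTop_atTop.eventually_ge_atTop (2 / t)] with n h1 h2 h3 h4 h5
  have hn : (0 : ℝ) < n := Nat.cast_pos.2 h3
  have hs : 0 < √(n : ℝ) := Real.sqrt_pos.2 hn
  have hss : √(n : ℝ) ^ 2 = n := Real.sq_sqrt hn.le
  rw [Real.dist_eq, sub_zero, abs_of_nonneg measureReal_nonneg]
  set b := B * √(n : ℝ) with hb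
  have hb0 : 0 < b := by positivity
  have hbb : b ^ 2 = B ^ 2 * n := by rw [hb, mul_pow, hss]
  have hbn : (n : ℝ) = b ^ 2 / B ^ 2 := by rw [hbb]; field_simp
  have hm1 : n * t / 2 ≤ (⌊n * t⌋₊ : ℝ) := by
    have := Nat.lt_floor_add_one (n * t)
    have h6 : 2 ≤ n * t := (div_le_iff₀ ht).1 h5
    linarith
  have hm2 : (⌊n * t⌋₊ : ℝ) ≤ n * t := Nat.floor_le (by positivity)
  have hconf := mul_measureReal_confined_le hξ hη hξ_indep hξ_ident hη_indep hη_ident hξη hσ hξ_L2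
    hξ_mean hξ_var hη_pos (a := δ * b) (b := b) (by positivity) (by nlinarith)
    (by rwa [show 2 * b / (δ * b) = 2 / δ by field_simp]) (hGpos _) ⌊n * t⌋₊
  have htot := measureReal_forall_le_le (b := b) hξ hξ_ident hξ_L2 hη_pos
    (show 0 < δ * b by positivity) ⌊n * t⌋₊
  change _ ≤ 2 / σ ^ 2 * (2 * (δ * b) * b + 3 * b * (M (2 * b) / G (2 * b))) + 1 / G (2 * b)
    at hconf
  change _ ≤ _ + _ * (T (δ * b) / (δ * b) ^ 2) at htot
  have hg := hGpos (2 * b)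
  have hp : P.real (confined ξ η (δ * b) b ⌊n * t⌋₊) ≤ K * δ + 24 * B ^ 2 / (σ ^ 2 * t) *
        (M (2 * b) / (2 * b * G (2 * b))) + 8 * B ^ 2 / t * (2 * b * G (2 * b))⁻¹ := by
    have h6 : n * t / 2 * P.real (confined ξ η (δ * b) b ⌊n * t⌋₊) ≤
        2 / σ ^ 2 * (2 * (δ * b) * b + 3 * b * (M (2 * b) / G (2 * b))) +
          2 * b * (1 / G (2 * b)) := by
      refine (mul_le_mul_of_nonneg_right hm1 measureReal_nonneg).trans (hconf.trans ?_)
      -- This crude loss of a factor `2b ≥ 1` is harmless: the new bound is `b²` times `4 / (2b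
      -- G(2b))`, which is still `o(b²)`.
      have : 1 / G (2 * b) ≤ 2 * b * (1 / G (2 * b)) :=
        le_mul_of_one_le_left (by positivity) h4
      linarith
    rw [← le_div_iff₀' (by positivity)] at h6
    refine h6.trans (le_of_eq ?_)
    rw [hK, hbn]
    field_simp
    ring
  have hq : ⌊n * t⌋₊ * (T (δ * b) / (δ * b) ^ 2) ≤ t / (δ * B) ^ 2 * T (δ * b) := by
    have hT0 : 0 ≤ T (δ * b) := integral_nonneg fun ω => indicator_nonneg (fun y _ => sq_nonneg y) _
    calc ⌊n * t⌋₊ * (T (δ * b) / (δ * b) ^ 2) ≤ n * t * (T (δ * b) / (δ * b) ^ 2) := by gcongr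
      _ = t / (δ * B) ^ 2 * T (δ * b) := by
        rw [hbn]
        field_simp
  linarith

end LeavingBands

/-! ### The supremum functional on paths -/

section Supremum

theorem le_rescaledMax (S : ℕ → ℝ) {n : ℕ} (hn : 0 < n) {t : ℝ} {j : ℕ}
    (hj : j ≤ ⌊n * t⌋₊) (ht : 0 ≤ t) : S j / √n ≤ rescaledMax S n t := by
  have hn' : (0 : ℝ) < n := Nat.cast_pos.2 hn
  have hjt : (j : ℝ) / n ∈ Icc 0 t := by
    refine ⟨by positivity, ?_⟩
    rw [div_le_iff₀' hn']
    exact (Nat.le_floor_iff (by positivity)).1 hj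
  -- An unbounded real supremum would default to `0`; here only finitely many values occur.
  have hbdd : BddAbove (range fun s : Icc (0 : ℝ) t => flatInterp S (n * s) / √n) := by
    refine (((Finset.range (⌊n * t⌋₊ + 1)).image fun k => S k / √n).finite_toSet.subset ?_).bddAbove
    rintro _ ⟨s, rfl⟩
    rw [Finset.mem_coe, Finset.mem_image]
    refine ⟨⌊(n : ℝ) * s⌋₊, Finset.mem_range.2 (Nat.lt_succ_of_le (Nat.floor_le_floor ?_)), rfl⟩
    exact mul_le_mul_of_nonneg_left s.2.2 hn'.le
  have := le_ciSup hbdd ⟨(j : ℝ) / n, hjt⟩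
  rwa [flatInterp, mul_div_cancel₀ _ hn'.ne', Nat.floor_natCast] at this

/-- The càdlàg functions with supremum smaller than `c`. -/
def SkorokhodSpace.supLt (c : ℝ) : Set SkorokhodSpace :=
  {x | ∃ C < c, ∀ t, x t ≤ C}

/-- Time changes preserve the supremum, so a `J₁`-perturbation smaller than half the margin `c - C`
keeps it below `c`. -/
theorem SkorokhodSpace.isOpen_supLt (c : ℝ) : IsOpen (SkorokhodSpace.supLt c) := by
  rw [EMetric.isOpen_iff]
  rintro x ⟨C, hC, hx⟩
  refine ⟨ENNReal.ofReal ((c - C) / 2), ENNReal.ofReal_pos.2 (by linarith), fun y hy => ?_⟩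
  rw [Metric.mem_eball, SkorokhodSpace.edist_eq, iInf_lt_iff] at hy
  obtain ⟨θ, hθ⟩ := hy
  refine ⟨C + (c - C) / 2, by linarith, fun t => ?_⟩
  have h1 : edist (y t) (x (θ t)) < ENNReal.ofReal ((c - C) / 2) :=
    ((le_iSup (fun t : unitInterval => edist (y t) (x (θ t))) t).trans (le_max_right _ _)).trans_lt hθ
  rw [edist_dist, ENNReal.ofReal_lt_ofReal_iff (by linarith), Real.dist_eq] at h1
  have h2 := le_abs_self (y t - x (θ t))
  have h3 := hx (θ t)
  linarith

/-- One-sided limits bound the path near each point, and `[0,1]` is compact. -/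
theorem SkorokhodSpace.bddAbove_range (x : SkorokhodSpace) : ∃ C : ℝ, ∀ t, x t ≤ C := by
  have hloc : ∀ t : unitInterval, ∃ C : ℝ, ∀ᶠ s in 𝓝 t, x s ≤ C := by
    intro t
    obtain ⟨h1, a, h2⟩ := x.cadlag t
    refine ⟨max (x t + 1) (a + 1), ?_⟩
    rw [← nhdsLT_sup_nhdsGE, eventually_sup]
    constructor
    · exact (h2.eventually_le_const (lt_add_one a)).mono fun s hs => hs.trans (le_max_right _ _)
    · exact (h1.eventually_le_const (lt_add_one (x t))).mono fun s hs => hs.trans (le_max_left _ _)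
  have := isCompact_univ.induction_on (p := fun s : Set unitInterval => ∃ C : ℝ, ∀ t ∈ s, x t ≤ C)
    ⟨0, by simp⟩ (fun s t hst ⟨C, hC⟩ => ⟨C, fun r hr => hC r (hst hr)⟩)
    (fun s t ⟨C, hC⟩ ⟨D, hD⟩ => ⟨max C D, fun r hr => hr.elim
      (fun h => (hC r h).trans (le_max_left _ _)) (fun h => (hD r h).trans (le_max_right _ _))⟩)
    (fun t _ => by
      obtain ⟨C, hC⟩ := hloc t
      exact ⟨_, mem_nhdsWithin_of_mem_nhds hC, C, fun s hs => hs⟩)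
  exact this.imp fun C hC t => hC t (mem_univ t)

theorem SkorokhodSpace.iUnion_supLt : ⋃ c : ℕ, SkorokhodSpace.supLt c = univ := by
  refine eq_univ_of_forall fun x => ?_
  obtain ⟨C, hC⟩ := x.bddAbove_range
  obtain ⟨c, hc⟩ := exists_nat_gt C
  exact mem_iUnion.2 ⟨c, C, hc, hC⟩

theorem le_of_rescaledPath_mem_supLt {S : ℕ → ℝ} {n : ℕ} (hn : 0 < n) {c : ℝ}
    (h : rescaledPath S n ∈ SkorokhodSpace.supLt c) {j : ℕ} (hj : j ≤ n) : S j ≤ c * √n := by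
  obtain ⟨C, hC, h⟩ := h
  have hn' : (0 : ℝ) < n := Nat.cast_pos.2 hn
  have hjn : (j : ℝ) / n ∈ unitInterval :=
    ⟨by positivity, (div_le_one hn').2 (Nat.cast_le.2 hj)⟩
  have h1 : flatInterp S (n * ((j : ℝ) / n)) / √n ≤ C := h ⟨(j : ℝ) / n, hjn⟩
  rw [flatInterp, mul_div_cancel₀ _ hn'.ne', Nat.floor_natCast,
    div_le_iff₀ (Real.sqrt_pos.2 hn')] at h1
  exact h1.trans (by gcongr)

end Supremum

/-! ### The main theorem -/

theorem theorem2 {Ω : Type*} [MeasurableSpace Ω] (P : ProbabilityMeasure Ω)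
    (ξ η : ℕ → Ω → ℝ)
    (hξ : ∀ n, Measurable (ξ n)) (hη : ∀ n, Measurable (η n))
    -- each of the two sequences is i.i.d., and they are independent of each other
    (hξ_indep : iIndepFun ξ (P : Measure Ω))
    (hξ_ident : ∀ n, IdentDistrib (ξ n) (ξ 0) (P : Measure Ω) (P : Measure Ω))
    (hη_indep : iIndepFun η (P : Measure Ω))
    (hη_ident : ∀ n, IdentDistrib (η n) (η 0) (P : Measure Ω) (P : Measure Ω))
    (hξη : IndepFun (fun ω n => ξ n ω) (fun ω n => η n ω) (P : Measure Ω))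
    -- `ξ` is centred with finite nonzero variance `σ²`
    (σ : ℝ) (hσ : 0 < σ)
    (hξ_L2 : MemLp (ξ 0) 2 (P : Measure Ω))
    (hξ_mean : ∫ ω, ξ 0 ω ∂(P : Measure Ω) = 0)
    (hξ_var : ∫ ω, ξ 0 ω ^ 2 ∂(P : Measure Ω) = σ ^ 2)
    -- `η` is positive with a slowly varying tail
    (hη_pos : ∀ n, ∀ᵐ ω ∂(P : Measure Ω), 0 < η n ω)
    (l : ℝ → ℝ) (hl : IsSlowlyVarying l)
    (hη_tail : Asymptotics.IsEquivalent atTop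
      (fun x : ℝ => (P : Measure Ω).real {ω | x < η 0 ω}) l) :
    (¬ ∃ μ : ProbabilityMeasure SkorokhodSpace,
      Tendsto (rescaledWalkLaw P hξ hη) atTop (𝓝 μ)) ∧
    ∀ t : ℝ, 0 < t →
      TendstoInfinityInProbability (P : Measure Ω)
        (fun n ω => rescaledMax (switchedWalk ξ η ω) n t) := by
  have key : ∀ t B : ℝ, 0 < t → 0 < B → Tendsto (fun n : ℕ =>
      (P : Measure Ω).real {ω | ∀ j ≤ ⌊n * t⌋₊, switchedWalk ξ η ω j ≤ B * √n}) atTop (𝓝 0) :=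
    fun t B ht hB => tendsto_measureReal_forall_le hξ hη hξ_indep hξ_ident hη_indep hη_ident hξη hσ
      hξ_L2 hξ_mean hξ_var hη_pos hl hη_tail ht hB
  constructor
  · rintro ⟨μ, hμ⟩
    have hzero : ∀ c : ℕ, (μ : Measure SkorokhodSpace) (SkorokhodSpace.supLt c) = 0 := by
      intro c
      have hopen := SkorokhodSpace.isOpen_supLt (c : ℝ)
      have h1 := ProbabilityMeasure.le_liminf_measure_open_of_tendsto hμ hopen
      have h2 : Tendsto (fun n => (rescaledWalkLaw P hξ hη n : Measure SkorokhodSpace)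
          (SkorokhodSpace.supLt c)) atTop (𝓝 0) := by
        have h3 := (ENNReal.tendsto_toReal_zero_iff fun n => measure_ne_top _ _).1
          -- The level is raised to `c + 1` because the estimate needs `B > 0` and `c` may be `0`.
          (key 1 (c + 1) one_pos (by positivity))
        refine tendsto_of_tendsto_of_tendsto_of_le_of_le' tendsto_const_nhds h3
          (Eventually.of_forall fun n => bot_le) ?_
        filter_upwards [eventually_gt_atTop 0] with n hn
        rw [rescaledWalkLaw, ProbabilityMeasure.map_apply' _ _ hopen.measurableSet]
        refine measure_mono fun ω hω j hj => ?_
        rw [mul_one, Nat.floor_natCast] at hj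
        refine (le_of_rescaledPath_mem_supLt hn hω hj).trans ?_
        gcongr
        linarith
      rw [h2.liminf_eq] at h1
      exact le_antisymm h1 (bot_le)
    have h4 := measure_iUnion_null hzero
    rw [SkorokhodSpace.iUnion_supLt, measure_univ] at h4
    exact one_ne_zero h4
  · intro t ht c
    have h1 := (ENNReal.tendsto_toReal_zero_iff fun n => measure_ne_top _ _).1
      (key t (|c| + 1) ht (by positivity))
    have h2 := ENNReal.Tendsto.sub (tendsto_const_nhds (x := (1 : ℝ≥0∞))) h1
      (Or.inl ENNReal.one_ne_top)
    rw [tsub_zero] at h2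
    refine tendsto_of_tendsto_of_tendsto_of_le_of_le' h2 tendsto_const_nhds ?_
      (Eventually.of_forall fun n => prob_le_one)
    filter_upwards [eventually_gt_atTop 0] with n hn
    rw [tsub_le_iff_right, ← measure_univ (μ := (P : Measure Ω))]
    refine (measure_mono fun ω _ => ?_).trans (measure_union_le _ _)
    by_cases h : c < rescaledMax (switchedWalk ξ η ω) n t
    · exact Or.inl h
    · refine Or.inr fun j hj => ?_
      have h3 := (le_rescaledMax (switchedWalk ξ η ω) hn hj ht.le).trans (not_lt.1 h)
      rw [div_le_iff₀ (Real.sqrt_pos.2 (Nat.cast_pos.2 hn))] at h3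
      refine h3.trans ?_
      gcongr
      linarith [le_abs_self c]
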